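/- Setting. Let $\tau>0$, let $n,m,r_1,r_2\ge 1$ be integers, let $\mathbb{U}=\mathbb{R}^{r_1}$ and $\mathbb{M}=\mathbb{R}^{r_2}$ carry some inner products, and let $\pi$ be a semiflow on a complete metric space $\mathcal{P}$. Let $\widetilde A\colon C([-\tau,0];\mathbb{R}^n)\to\mathbb{R}^n$, $C\colon C([-\tau,0];\mathbb{R}^n)\to\mathbb{M}$ and $\widetilde B\colon\mathbb{U}\to\mathbb{R}^n$ be bounded linear operators, and let $F'\colon\mathcal{P}\to\mathcal{L}(\mathbb{M};\mathbb{U})$ be continuous with $\|F'(\wp)\|\le\Lambda$ for all $\wp\in\mathcal{P}$ and some $\Lambda>0$. For $\wp\in\mathcal{P}$ consider the delay equation $$\dot x(t)=\widetilde A x_t+\widetilde B F'(\pi^t(\wp))Cx_t,\qquad x_t(\theta)=x(t+\theta),\ \theta\in[-\tau,0].$$ Let $\mathbb{H}=L_2([-\tau,0];\mu;\mathbb{R}^n)$, where $\mu$ is the sum of the Lebesgue measure on $[-\tau,0]$ and the unit mass at $0$; the space $C([-\tau,0];\mathbb{R}^n)$ is densely embedded into $\mathbb{H}$. Let $\Xi$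 be the linear cocycle in $\mathbb{H}$ over $(\mathcal{P},\pi)$ generated by the equation: $\Xi^t(\wp,\cdot)\in\mathcal{L}(\mathbb{H})$, for $t\ge0$, is the unique bounded operator that maps the initial function $x_0\in C([-\tau,0];\mathbb{R}^n)$ of any classical solution $x$ over $\wp$ to $x_t$. Let $\mathbb{H}^{\wedge m}$ be the $m$-fold exterior power of $\mathbb{H}$, i.e. the image of the orthogonal projector $\frac1{m!}\sum_{\sigma\in\mathbb{S}_m}(-1)^\sigma S_\sigma$ in the Hilbert tensor power $\mathbb{H}^{\otimes m}$, where $S_\sigma(v_1\otimes\dots\otimes v_m)=v_{\sigma(1)}\otimes\dots\otimes v_{\sigma(m)}$. (It is identified with the space $\mathcal{L}^{\wedge}_m$ of antisymmetric functions in $L_2([-\tau,0]^m;\mu^{\otimes m};(\mathbb{R}^n)^{\otimes m})$.) Let $\Xi_m$ be the $m$-fold antisymmetric multiplicative compound of $\Xi$: $\Xi_m^t(\wp,\cdot)$ is the restriction to $\mathbb{H}^{\wedge m}$ of the $m$-fold tensor power of $\Xi^t(\wp,\cdot)$. Statement. Suppose that there are a bounded self-adjoint operator $P\in\mathcal{L}(\mathbb{H}^{\wedge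 m})$ whose quadratic form $V(\Phi)=(\Phi,P\Phi)$ is positive-definite (that is, $V(\Phi)>0$ for $\Phi\ne0$), a number $\nu_0\in\mathbb{R}$ and a number $\delta_V>0$ such that $$e^{2\nu_0 t}V(\Xi_m^t(\wp,\Phi))-V(\Phi)\le-\delta_V\int_0^t e^{2\nu_0 s}|\Xi_m^s(\wp,\Phi)|^2\,ds$$ for all $t\ge0$, $\wp\in\mathcal{P}$ and $\Phi\in\mathbb{H}^{\wedge m}$. Then there is a constant $M>0$ such that $$|\Xi_m^t(\wp,\Phi)|\le Me^{-\nu_0 t}|\Phi|\quad\text{for all } t\ge0,\ \wp\in\mathcal{P},\ \Phi\in\mathbb{H}^{\wedge m}.$$ In particular, if $\nu_0>0$, then $\Xi_m$ is uniformly exponentially stable with the exponent $\nu_0$. -/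

import Mathlib

noncomputable section

namespace DelayCompound

open scoped TensorProduct Matrix NNReal
open MeasureTheory Set

section Tensor

/-- The algebraic tensor product `H ⊙ ⋯ ⊙ H` (`m` factors). It is a copy of Mathlib's
`⨂[ℝ] _ : Fin m, H`, so that it can carry the Hilbertian norm below instead of the projective
norm. -/
def AlgTensor (H : Type*) [NormedAddCommGroup H] [InnerProductSpace ℝ H] (m : ℕ) : Type _ :=
  ⨂[ℝ] (_ : Fin m), H

variable {H : Type*} [NormedAddCommGroup H] [InnerProductSpace ℝ H] {m : ℕ}

instance : AddCommGroup (AlgTensor H m) := inferInstanceAs (AddCommGroup (⨂[ℝ] (_ : Fin m), H))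

instance : Module ℝ (AlgTensor H m) := inferInstanceAs (Module ℝ (⨂[ℝ] (_ : Fin m), H))

/-- The decomposable tensor `v 0 ⊗ ⋯ ⊗ v (m - 1)`. -/
def tmul (v : Fin m → H) : AlgTensor H m := PiTensorProduct.tprod ℝ v

/-- The bilinear form with `(v₁ ⊗ ⋯ ⊗ vₘ, w₁ ⊗ ⋯ ⊗ wₘ) = ∏ i, (vᵢ, wᵢ)`. -/
def innerForm : AlgTensor H m →ₗ[ℝ] AlgTensor H m →ₗ[ℝ] ℝ :=
  PiTensorProduct.dualDistrib ∘ₗ PiTensorProduct.map (fun _ : Fin m => innerₗ H)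

theorem innerForm_tmul (v w : Fin m → H) :
    innerForm (tmul v) (tmul w) = ∏ i, inner ℝ (v i) (w i) := by
  change PiTensorProduct.dualDistrib (PiTensorProduct.map (fun _ : Fin m => innerₗ H)
    (PiTensorProduct.tprod ℝ v)) (PiTensorProduct.tprod ℝ w) = _
  rw [PiTensorProduct.map_tprod, PiTensorProduct.dualDistrib_apply]
  simp

/-- The transposition operator with `v₁ ⊗ ⋯ ⊗ vₘ ↦ v_{σ(1)} ⊗ ⋯ ⊗ v_{σ(m)}` on algebraic
tensors. -/
def algPerm (σ : Equiv.Perm (Fin m)) : AlgTensor H m →ₗ[ℝ] AlgTensor H m :=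
  (PiTensorProduct.reindex ℝ (fun _ : Fin m => H) σ.symm).toLinearMap

theorem algPerm_tmul (σ : Equiv.Perm (Fin m)) (v : Fin m → H) :
    algPerm σ (tmul v) = tmul (fun i => v (σ i)) := by
  exact PiTensorProduct.reindex_tprod (R := ℝ) (s := fun _ : Fin m => H) σ.symm v

/-- The map `v₁ ⊗ ⋯ ⊗ vₘ ↦ G v₁ ⊗ ⋯ ⊗ G vₘ` on algebraic tensors. -/
def algMap (G : H →L[ℝ] H) : AlgTensor H m →ₗ[ℝ] AlgTensor H m :=
  PiTensorProduct.map (fun _ : Fin m => (G : H →ₗ[ℝ] H))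

theorem algMap_tmul (G : H →L[ℝ] H) (v : Fin m → H) :
    algMap G (tmul v) = tmul (fun i => G (v i)) := by
  exact PiTensorProduct.map_tprod (fun _ : Fin m => (G : H →ₗ[ℝ] H)) v

theorem exists_sum_tmul (x : AlgTensor H m) :
    ∃ (N : ℕ) (c : Fin N → ℝ) (v : Fin N → Fin m → H), x = ∑ i, c i • tmul (v i) := by
  refine PiTensorProduct.induction_on (motive := fun x : ⨂[ℝ] (_ : Fin m), H =>
    ∃ (N : ℕ) (c : Fin N → ℝ) (v : Fin N → Fin m → H),
      (show AlgTensor H m from x) = ∑ i, c i • tmul (v i)) x ?_ ?_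
  · intro r f
    exact ⟨1, fun _ => r, fun _ => f, by simp; rfl⟩
  · rintro x y ⟨N, c, v, hx⟩ ⟨N', c', v', hy⟩
    refine ⟨N + N', Fin.append c c', Fin.append v v', ?_⟩
    rw [Fin.sum_univ_add]
    simp only [Fin.append_left, Fin.append_right]
    rw [← hx, ← hy]
    rfl

theorem alg_ext {F : Type*} [AddCommGroup F] [Module ℝ F] {f g : AlgTensor H m →ₗ[ℝ] F}
    (h : ∀ v, f (tmul v) = g (tmul v)) : f = g := by
  refine LinearMap.ext fun x => ?_
  obtain ⟨N, c, v, rfl⟩ := exists_sum_tmul x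
  simp [h]

theorem innerForm_comm (x y : AlgTensor H m) : innerForm x y = innerForm y x := by
  have : (innerForm : AlgTensor H m →ₗ[ℝ] _) = innerForm.flip := by
    refine alg_ext fun v => alg_ext fun w => ?_
    simp [innerForm_tmul, real_inner_comm]
  exact congr($this x y)

theorem posSemidef_prod_sub_prod {N : ℕ} (A B : Fin m → Matrix (Fin N) (Fin N) ℝ)
    (hA : ∀ k, (A k).PosSemidef) (hB : ∀ k, (B k - A k).PosSemidef) (s : Finset (Fin m)) :
    (Matrix.of fun i j => ∏ k ∈ s, A k i j).PosSemidef ∧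
      ((Matrix.of fun i j => ∏ k ∈ s, B k i j) -
        Matrix.of fun i j => ∏ k ∈ s, A k i j).PosSemidef := by
  classical
  induction s using Finset.induction_on with
  | empty =>
    refine ⟨?_, by simpa using Matrix.PosSemidef.zero⟩
    rw [Matrix.posSemidef_iff_dotProduct_mulVec]
    refine ⟨by ext i j; simp, fun x => ?_⟩
    simp only [Finset.prod_empty, dotProduct, Matrix.mulVec, Pi.star_apply, star_trivial,
      Matrix.of_apply, one_mul]
    rw [← Finset.sum_mul]
    exact mul_self_nonneg _
  | insert a s ha ih =>
    obtain ⟨h1, h2⟩ := ih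
    simp only [Finset.prod_insert ha]
    refine ⟨(hA a).hadamard h1, ?_⟩
    have hB' : (B a).PosSemidef := by simpa using (hB a).add (hA a)
    have e : ((Matrix.of fun i j => B a i j * ∏ k ∈ s, B k i j) -
        Matrix.of fun i j => A a i j * ∏ k ∈ s, A k i j) =
        (B a) ⊙ ((Matrix.of fun i j => ∏ k ∈ s, B k i j) -
        Matrix.of fun i j => ∏ k ∈ s, A k i j) +
        (B a - A a) ⊙ (Matrix.of fun i j => ∏ k ∈ s, A k i j) := by
      ext i j
      simp [Matrix.hadamard]
      ring
    rw [e]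
    exact (hB'.hadamard h2).add ((hB a).hadamard h1)

theorem innerForm_sum {N : ℕ} (c : Fin N → ℝ) (v : Fin N → Fin m → H) :
    innerForm (∑ i, c i • tmul (v i)) (∑ i, c i • tmul (v i)) =
      star c ⬝ᵥ (Matrix.of fun i j => ∏ k, inner ℝ (v i k) (v j k)) *ᵥ c := by
  simp only [map_sum, LinearMap.sum_apply, map_smul, LinearMap.smul_apply, innerForm_tmul,
    dotProduct, Matrix.mulVec, Matrix.of_apply, smul_eq_mul, Pi.star_apply, star_trivial,
    Finset.mul_sum]
  rw [Finset.sum_comm]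
  exact Finset.sum_congr rfl fun i _ => Finset.sum_congr rfl fun j _ => by ring

theorem innerForm_self_nonneg (x : AlgTensor H m) : 0 ≤ innerForm x x := by
  obtain ⟨N, c, v, rfl⟩ := exists_sum_tmul x
  rw [innerForm_sum]
  have h := (posSemidef_prod_sub_prod (fun k => Matrix.gram ℝ fun i => v i k)
    (fun k => Matrix.gram ℝ fun i => v i k) (fun k => Matrix.posSemidef_gram ℝ _)
    (fun k => by simpa using Matrix.PosSemidef.zero) Finset.univ).1
  exact h.dotProduct_mulVec_nonneg c

theorem innerForm_algMap_le (G : H →L[ℝ] H) (x : AlgTensor H m) :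
    innerForm (algMap G x) (algMap G x) ≤ (‖G‖ ^ m) ^ 2 * innerForm x x := by
  obtain ⟨N, c, v, rfl⟩ := exists_sum_tmul x
  simp only [map_sum (algMap G), map_smul (algMap G), algMap_tmul]
  rw [innerForm_sum, innerForm_sum]
  have h := (posSemidef_prod_sub_prod (fun k => Matrix.gram ℝ fun i => G (v i k))
    (fun k => ‖G‖ ^ 2 • Matrix.gram ℝ fun i => v i k) (fun k => Matrix.posSemidef_gram ℝ _)
    (fun k => Matrix.posSemidef_opNorm_smul_gram_sub_gram (fun i => v i k) G) Finset.univ).2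
  have h' := h.dotProduct_mulVec_nonneg c
  rw [Matrix.sub_mulVec, dotProduct_sub, sub_nonneg] at h'
  refine h'.trans_eq ?_
  have : (Matrix.of fun i j => ∏ k : Fin m, (‖G‖ ^ 2 • Matrix.gram ℝ fun i => v i k) i j) =
      (‖G‖ ^ m) ^ 2 • Matrix.of fun i j => ∏ k : Fin m, inner ℝ (v i k) (v j k) := by
    ext i j
    simp [Matrix.gram_apply, Finset.prod_mul_distrib, pow_right_comm]
  rw [this, Matrix.smul_mulVec, dotProduct_smul, smul_eq_mul]

theorem innerForm_algPerm (σ : Equiv.Perm (Fin m)) (x : AlgTensor H m) :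
    innerForm (algPerm σ x) (algPerm σ x) = innerForm x x := by
  obtain ⟨N, c, v, rfl⟩ := exists_sum_tmul x
  simp only [map_sum (algPerm σ), map_smul (algPerm σ), algPerm_tmul]
  rw [innerForm_sum, innerForm_sum]
  congr 3
  ext i j
  exact Equiv.prod_comp σ fun k => inner ℝ (v i k) (v j k)

/-- The inner product of algebraic tensors. -/
@[reducible]
def algCore : PreInnerProductSpace.Core ℝ (AlgTensor H m) where
  inner x y := innerForm x y
  conj_inner_symm x y := by simpa using innerForm_comm y x
  re_inner_nonneg x := by simpa using innerForm_self_nonneg x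
  add_left x y z := by simp
  smul_left x y r := by simp

instance : SeminormedAddCommGroup (AlgTensor H m) :=
  InnerProductSpace.Core.toSeminormedAddCommGroup (𝕜 := ℝ) (c := algCore)

instance : InnerProductSpace ℝ (AlgTensor H m) := InnerProductSpace.ofCore algCore

theorem inner_tmul (v w : Fin m → H) :
    inner ℝ (tmul v) (tmul w) = ∏ i, inner ℝ (v i) (w i) := innerForm_tmul v w

theorem norm_sq_alg (x : AlgTensor H m) : ‖x‖ ^ 2 = innerForm x x :=
  (real_inner_self_eq_norm_sq x).symm

variable (H m) in
/-- The Hilbert tensor power `H^{⊗ m}`, the (Hausdorff) completion of the algebraic one. -/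
abbrev TensorPow : Type _ := UniformSpace.Completion (AlgTensor H m)

/-- The `m`-fold multiplicative compound `G^{⊗ m}` of a bounded operator `G`. -/
def tensorMap (m : ℕ) (G : H →L[ℝ] H) : TensorPow H m →L[ℝ] TensorPow H m :=
  ((algMap G).mkContinuous (‖G‖ ^ m) fun x => by
    have h := innerForm_algMap_le (m := m) G x
    rw [← norm_sq_alg, ← norm_sq_alg, ← mul_pow] at h
    exact le_of_sq_le_sq h (by positivity)).completion

/-- The transposition operator `S_σ` on `H^{⊗ m}`. -/
def permOp (σ : Equiv.Perm (Fin m)) : TensorPow H m →L[ℝ] TensorPow H m :=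
  ((algPerm σ).mkContinuous 1 fun x => by
    have h := innerForm_algPerm σ x
    rw [← norm_sq_alg, ← norm_sq_alg] at h
    rw [one_mul]
    exact le_of_sq_le_sq h.le (norm_nonneg _)).completion

theorem tensorMap_tmul (G : H →L[ℝ] H) (v : Fin m → H) :
    tensorMap m G ((tmul v : AlgTensor H m) : TensorPow H m) = ((tmul fun i => G (v i) : AlgTensor H m) : TensorPow H m) := by
  simp [tensorMap, algMap_tmul]

theorem permOp_tmul (σ : Equiv.Perm (Fin m)) (v : Fin m → H) :
    permOp σ ((tmul v : AlgTensor H m) : TensorPow H m) = ((tmul fun i => v (σ i) : AlgTensor H m) : TensorPow H m) := by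
  simp [permOp, algPerm_tmul]

variable (H m) in
/-- The projector `Π = (1 / m!) ∑ σ, (-1)^σ S_σ` of `H^{⊗ m}` onto the exterior power. -/
def altProj : TensorPow H m →L[ℝ] TensorPow H m :=
  ((m.factorial : ℝ)⁻¹) • ∑ σ : Equiv.Perm (Fin m), ((Equiv.Perm.sign σ : ℤ) : ℝ) • permOp σ

variable (H m) in
/-- The `m`-fold exterior power `H^{∧ m}`, the image of `altProj` in `H^{⊗ m}`. -/
abbrev ExtPow : Submodule ℝ (TensorPow H m) := LinearMap.range (altProj H m).toLinearMap

theorem tensorMap_permOp (G : H →L[ℝ] H) (σ : Equiv.Perm (Fin m)) (x : TensorPow H m) :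
    tensorMap m G (permOp σ x) = permOp σ (tensorMap m G x) := by
  induction x using UniformSpace.Completion.induction_on with
  | hp => exact isClosed_eq (by fun_prop) (by fun_prop)
  | ih x =>
    have : algMap G ∘ₗ algPerm σ = algPerm σ ∘ₗ (algMap G : AlgTensor H m →ₗ[ℝ] _) :=
      alg_ext fun v => by simp [algMap_tmul, algPerm_tmul]
    have h : algMap G (algPerm σ x) = algPerm σ (algMap G x) := congr($this x)
    simp [tensorMap, permOp, h]

theorem tensorMap_altProj (G : H →L[ℝ] H) (x : TensorPow H m) :
    tensorMap m G (altProj H m x) = altProj H m (tensorMap m G x) := by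
  simp [altProj, tensorMap_permOp]

theorem permOp_permOp (σ ρ : Equiv.Perm (Fin m)) (x : TensorPow H m) :
    permOp σ (permOp ρ x) = permOp (ρ * σ) x := by
  induction x using UniformSpace.Completion.induction_on with
  | hp => exact isClosed_eq (by fun_prop) (by fun_prop)
  | ih x =>
    have : algPerm σ ∘ₗ algPerm ρ = (algPerm (ρ * σ) : AlgTensor H m →ₗ[ℝ] _) :=
      alg_ext fun v => by simp [algPerm_tmul]
    have h : algPerm σ (algPerm ρ x) = algPerm (ρ * σ) x := congr($this x)
    simp [permOp, h]

theorem altProj_apply (x : TensorPow H m) : altProj H m x = ((m.factorial : ℝ)⁻¹) •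
    ∑ σ : Equiv.Perm (Fin m), ((Equiv.Perm.sign σ : ℤ) : ℝ) • permOp σ x := by
  simp [altProj]

theorem permOp_altProj (σ : Equiv.Perm (Fin m)) (x : TensorPow H m) :
    permOp σ (altProj H m x) = ((Equiv.Perm.sign σ : ℤ) : ℝ) • altProj H m x := by
  have hs : ∀ ρ : Equiv.Perm (Fin m), ((Equiv.Perm.sign ρ : ℤ) : ℝ) =
      ((Equiv.Perm.sign σ : ℤ) : ℝ) * ((Equiv.Perm.sign (ρ * σ) : ℤ) : ℝ) := fun ρ => by
    rcases Int.units_eq_one_or (Equiv.Perm.sign σ) with h | h <;> simp [h]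
  rw [altProj_apply, map_smul, map_sum, smul_comm]
  congr 1
  rw [Finset.smul_sum, ← Equiv.sum_comp (Equiv.mulRight σ) fun ρ => ((Equiv.Perm.sign σ : ℤ) : ℝ) •
      ((Equiv.Perm.sign ρ : ℤ) : ℝ) • permOp ρ x]
  refine Finset.sum_congr rfl fun ρ _ => ?_
  rw [Equiv.coe_mulRight, smul_smul, ← hs, map_smul, permOp_permOp]

theorem altProj_altProj (x : TensorPow H m) : altProj H m (altProj H m x) = altProj H m x := by
  have hs : ∀ σ : Equiv.Perm (Fin m), ((Equiv.Perm.sign σ : ℤ) : ℝ) *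
      ((Equiv.Perm.sign σ : ℤ) : ℝ) = 1 := fun σ => by
    rcases Int.units_eq_one_or (Equiv.Perm.sign σ) with h | h <;> simp [h]
  rw [altProj_apply (altProj H m x)]
  simp only [permOp_altProj, smul_smul, hs, one_smul, Finset.sum_const, Finset.card_univ,
    Fintype.card_perm, Fintype.card_fin]
  rw [← Nat.cast_smul_eq_nsmul ℝ, smul_smul, inv_mul_cancel₀ (by positivity), one_smul]

instance : CompleteSpace (ExtPow H m) := by
  have h : (ExtPow H m : Set (TensorPow H m)) = {x | altProj H m x = x} := by
    ext x
    refine ⟨?_, fun hx => ⟨x, hx⟩⟩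
    rintro ⟨y, rfl⟩
    exact altProj_altProj y
  have hc : IsClosed (ExtPow H m : Set (TensorPow H m)) := by
    rw [h]
    exact isClosed_eq (by fun_prop) (by fun_prop)
  exact hc.completeSpace_coe

/-- The `m`-fold antisymmetric multiplicative compound `G^{∧ m}`, the restriction of `G^{⊗ m}` to
`H^{∧ m}`. -/
def extMap (m : ℕ) (G : H →L[ℝ] H) : ExtPow H m →L[ℝ] ExtPow H m :=
  ((tensorMap m G).comp (ExtPow H m).subtypeL).codRestrict (ExtPow H m) (by
    rintro ⟨_, x, rfl⟩
    exact ⟨tensorMap m G x, (tensorMap_altProj G x).symm⟩)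

end Tensor

section Delay

/-- The data of the delay equation `x'(t) = Ã x_t + B̃ F'(π^t ℘) C x_t` in a Euclidean space `X`
(in the theorem, `X = ℝⁿ`), driven by a semiflow `π` on `P`. Here `A` and `B` stand for `Ã`, `B̃`.
The spaces `U` and `M` are `ℝ^{r₁}` and `ℝ^{r₂}` with arbitrary inner products. -/
structure DelaySystem (P M U X : Type*) [MetricSpace P]
    [NormedAddCommGroup M] [InnerProductSpace ℝ M]
    [NormedAddCommGroup U] [InnerProductSpace ℝ U]
    [NormedAddCommGroup X] [InnerProductSpace ℝ X] where
  /-- the delay -/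
  τ : ℝ
  τ_pos : 0 < τ
  /-- the driving semiflow -/
  flow : Flow ℝ≥0 P
  A : C(Icc (-τ) 0, X) →L[ℝ] X
  B : U →L[ℝ] X
  C : C(Icc (-τ) 0, X) →L[ℝ] M
  F' : P → M →L[ℝ] U
  continuous_F' : Continuous F'
  Λ : ℝ
  Λ_pos : 0 < Λ
  norm_F'_le : ∀ p, ‖F' p‖ ≤ Λ

variable {P M U X : Type*} [MetricSpace P]
  [NormedAddCommGroup M] [InnerProductSpace ℝ M]
  [NormedAddCommGroup U] [InnerProductSpace ℝ U]
  [NormedAddCommGroup X] [InnerProductSpace ℝ X]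

namespace DelaySystem

variable (D : DelaySystem P M U X)

theorem zero_mem : (0 : ℝ) ∈ Icc (-D.τ) 0 := ⟨by linarith [D.τ_pos], le_rfl⟩

/-- The measure on `[-τ, 0]` that is the sum of the Lebesgue measure and the unit mass at `0`. -/
def μ : Measure (Icc (-D.τ) 0) := 
  (volume : Measure ℝ).comap Subtype.val + Measure.dirac (⟨0, D.zero_mem⟩ : Icc (-D.τ) 0)

instance : IsFiniteMeasure D.μ := by
  have : IsFiniteMeasure ((volume : Measure ℝ).comap (Subtype.val : Icc (-D.τ) 0 → ℝ)) := by
    refine ⟨?_⟩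
    rw [comap_subtype_coe_apply measurableSet_Icc, image_univ, Subtype.range_coe]
    exact measure_Icc_lt_top
  unfold μ
  infer_instance

/-- The Hilbert space `L₂([-τ, 0]; μ; X)`. -/
abbrev H : Type _ := Lp X 2 D.μ

/-- The embedding of `C([-τ, 0]; X)` into `L₂([-τ, 0]; μ; X)`. -/
def incl : C(Icc (-D.τ) 0, X) →L[ℝ] D.H := ContinuousMap.toLp 2 D.μ ℝ

/-- The history segment `x_t : θ ↦ x (t + θ)`, `θ ∈ [-τ, 0]`. -/
def hist (x : C(ℝ, X)) (t : ℝ) :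
    C(Icc (-D.τ) 0, X) :=
  ⟨fun θ => x (t + θ), by fun_prop⟩

/-- The right-hand side `Ã + B̃ F'(π^t ℘) C` of the equation at time `t ≥ 0`. -/
def rhs (p : P) (t : ℝ) :
    C(Icc (-D.τ) 0, X) →L[ℝ] X :=
  D.A + D.B ∘L D.F' (D.flow t.toNNReal p) ∘L D.C

/-- `x` is a classical solution on `[-τ, ∞)` over `p` with the initial function `ψ`. (The values of
`x` on `(-∞, -τ)` play no role; the derivative at `t = 0` is one-sided.) -/
structure IsSolution (p : P) (ψ : C(Icc (-D.τ) 0, X))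
    (x : C(ℝ, X)) : Prop where
  initial : ∀ θ : Icc (-D.τ) 0, x θ = ψ θ
  hasDeriv : ∀ t : ℝ, 0 ≤ t → HasDerivWithinAt x (D.rhs p t (D.hist x t)) (Ici 0) t

theorem continuous_rhs (p : P) : Continuous (D.rhs p) := by
  have h : Continuous fun t : ℝ => D.F' (D.flow t.toNNReal p) :=
    D.continuous_F'.comp (D.flow.continuous continuous_real_toNNReal continuous_const)
  exact continuous_const.add (continuous_const.clm_comp (h.clm_comp continuous_const))

theorem exists_norm_rhs_le : ∃ K : ℝ, 0 < K ∧ ∀ p t, ‖D.rhs p t‖ ≤ K := by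
  refine ⟨‖D.A‖ + ‖D.B‖ * (D.Λ * ‖D.C‖) + 1, by have := D.Λ_pos; positivity, fun p t => ?_⟩
  have h1 : ‖D.rhs p t‖ ≤ ‖D.A‖ + ‖D.B ∘L D.F' (D.flow t.toNNReal p) ∘L D.C‖ :=
    norm_add_le D.A _
  have h2 := D.B.opNorm_comp_le (D.F' (D.flow t.toNNReal p) ∘L D.C)
  have h3 := (D.F' (D.flow t.toNNReal p)).opNorm_comp_le D.C
  have h4 := D.norm_F'_le (D.flow t.toNNReal p)
  have h5 : ‖D.B‖ * ‖D.F' (D.flow t.toNNReal p) ∘L D.C‖ ≤ ‖D.B‖ * (D.Λ * ‖D.C‖) := by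
    gcongr
    exact h3.trans (by gcongr)
  linarith

theorem continuous_hist (x : C(ℝ, X)) : Continuous (D.hist x) :=
  (ContinuousMap.curry (⟨fun q : ℝ × Icc (-D.τ) 0 => x (q.1 + q.2), by fun_prop⟩ :
    C(ℝ × Icc (-D.τ) 0, X))).continuous

theorem continuous_rhs_hist (p : P) (x : C(ℝ, X)) :
    Continuous fun t => D.rhs p t (D.hist x t) :=
  (D.continuous_rhs p).clm_apply (D.continuous_hist x)

theorem hist_add (x y : C(ℝ, X)) (t : ℝ) :
    D.hist (x + y) t = D.hist x t + D.hist y t := rfl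

theorem hist_sub (x y : C(ℝ, X)) (t : ℝ) :
    D.hist (x - y) t = D.hist x t - D.hist y t := rfl

theorem hist_smul (c : ℝ) (x : C(ℝ, X)) (t : ℝ) :
    D.hist (c • x) t = c • D.hist x t := rfl

theorem IsSolution.add {D : DelaySystem P M U X} {p : P}
    {ψ φ : C(Icc (-D.τ) 0, X)}
    {x y : C(ℝ, X)} (hx : D.IsSolution p ψ x) (hy : D.IsSolution p φ y) :
    D.IsSolution p (ψ + φ) (x + y) where
  initial θ := by simp [hx.initial, hy.initial]
  hasDeriv t ht := by
    rw [hist_add, map_add]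
    exact (hx.hasDeriv t ht).add (hy.hasDeriv t ht)

theorem IsSolution.smul {D : DelaySystem P M U X} {p : P}
    {ψ : C(Icc (-D.τ) 0, X)}
    {x : C(ℝ, X)} (c : ℝ) (hx : D.IsSolution p ψ x) :
    D.IsSolution p (c • ψ) (c • x) where
  initial θ := by simp [hx.initial]
  hasDeriv t ht := by
    rw [hist_smul, map_smul]
    exact (hx.hasDeriv t ht).const_smul c

theorem norm_integral_rhs_le {K : ℝ} (hK : 0 < K) (p : P) (hp : ∀ t, ‖D.rhs p t‖ ≤ K)
    (z : C(ℝ, X)) {c : ℝ} (hc : 0 ≤ c)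
    (hz : ∀ t, ‖z t‖ ≤ c * Real.exp (2 * K * max t 0)) (t : ℝ) :
    ‖∫ s in (0 : ℝ)..max t 0, D.rhs p s (D.hist z s)‖ ≤
      c / 2 * Real.exp (2 * K * max t 0) := by
  have ht : 0 ≤ max t 0 := le_max_right _ _
  have h1 : ‖∫ s in (0 : ℝ)..max t 0, D.rhs p s (D.hist z s)‖ ≤
      ∫ s in (0 : ℝ)..max t 0, K * (c * Real.exp (2 * K * s)) := by
    refine intervalIntegral.norm_integral_le_of_norm_le ht ?_
      (Continuous.intervalIntegrable (by fun_prop) _ _)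
    refine Filter.Eventually.of_forall fun s hs => ?_
    refine (ContinuousLinearMap.le_opNorm _ _).trans ?_
    gcongr
    · exact hp s
    · refine (ContinuousMap.norm_le _ (by positivity)).2 fun θ => (hz _).trans ?_
      gcongr
      exact max_le (by have := θ.2.2; linarith) hs.1.le
  refine h1.trans ?_
  have h2 : ∫ s in (0 : ℝ)..max t 0, K * (c * Real.exp (2 * K * s)) =
      c / 2 * Real.exp (2 * K * max t 0) - c / 2 := by
    have : ∀ s ∈ uIcc 0 (max t 0), HasDerivAt (fun s => c / 2 * Real.exp (2 * K * s))
        (K * (c * Real.exp (2 * K * s))) s := fun s _ => by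
      have := ((hasDerivAt_id s).const_mul (2 * K)).exp.const_mul (c / 2)
      convert! this using 1
      simp
      ring
    rw [intervalIntegral.integral_eq_sub_of_hasDerivAt this
      (Continuous.intervalIntegrable (by fun_prop) _ _)]
    simp
  rw [h2]
  linarith

/-- The Picard operator of the equation. -/
def picard (p : P) (ψ : C(Icc (-D.τ) 0, X))
    (x : C(ℝ, X)) : C(ℝ, X) where
  toFun t := ψ (projIcc (-D.τ) 0 (by linarith [D.τ_pos]) t) +
    ∫ s in (0 : ℝ)..max t 0, D.rhs p s (D.hist x s)
  continuous_toFun := by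
    refine (ψ.continuous.comp continuous_projIcc).add ?_
    have h := intervalIntegral.continuous_primitive (μ := volume)
      (fun a b => (D.continuous_rhs_hist p x).intervalIntegrable a b) 0
    exact h.comp (by fun_prop : Continuous fun t : ℝ => max t 0)

theorem norm_sq_incl_hist (x : C(ℝ, X)) (t : ℝ) :
    ‖D.incl (D.hist x t)‖ ^ 2 = (∫ s in (t - D.τ)..t, ‖x s‖ ^ 2) + ‖x t‖ ^ 2 := by
  have hf : ∀ ν : Measure (Icc (-D.τ) 0), ∀ [IsFiniteMeasure ν],
      Integrable (fun θ : Icc (-D.τ) 0 => ‖x (t + θ)‖ ^ 2) ν := fun ν _ =>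
    Continuous.integrable_of_hasCompactSupport (by fun_prop)
      (HasCompactSupport.of_compactSpace _)
  have hfin : IsFiniteMeasure
      ((volume : Measure ℝ).comap (Subtype.val : Icc (-D.τ) 0 → ℝ)) := by
    refine ⟨?_⟩
    rw [comap_subtype_coe_apply measurableSet_Icc, image_univ, Subtype.range_coe]
    exact measure_Icc_lt_top
  rw [← real_inner_self_eq_norm_sq, L2.inner_def]
  have h1 : ∫ θ, inner ℝ (D.incl (D.hist x t) θ) (D.incl (D.hist x t) θ) ∂D.μ =
      ∫ θ : Icc (-D.τ) 0, ‖x (t + θ)‖ ^ 2 ∂D.μ := by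
    refine integral_congr_ae ?_
    filter_upwards [ContinuousMap.coeFn_toLp (p := 2) (𝕜 := ℝ) D.μ (D.hist x t)] with θ hθ
    rw [real_inner_self_eq_norm_sq]
    change ‖(ContinuousMap.toLp 2 D.μ ℝ (D.hist x t)) θ‖ ^ 2 = _
    rw [hθ]
    rfl
  rw [h1, μ, integral_add_measure (hf _) (hf _), integral_dirac]
  have h2 := integral_subtype_comap (μ := volume) (measurableSet_Icc (a := -D.τ) (b := 0))
    (fun θ => ‖x (t + θ)‖ ^ 2)
  rw [h2, integral_Icc_eq_integral_Ioc,
    ← intervalIntegral.integral_of_le (by linarith [D.τ_pos])]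
  rw [intervalIntegral.integral_comp_add_left (fun s => ‖x s‖ ^ 2) t]
  simp [sub_eq_add_neg]

theorem IsSolution.hist_zero {D : DelaySystem P M U X} {p : P} {ψ : C(Icc (-D.τ) 0, X)}
    {x : C(ℝ, X)} (hx : D.IsSolution p ψ x) : D.hist x 0 = ψ := by
  ext1 θ
  simpa [hist] using hx.initial θ

theorem sq_integral_norm_le (x : C(ℝ, X)) :
    (∫ s in (-D.τ)..0, ‖x s‖) ^ 2 ≤ D.τ * ∫ s in (-D.τ)..0, ‖x s‖ ^ 2 := by
  have hτ := D.τ_pos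
  set m := ∫ s in (-D.τ)..0, ‖x s‖ with hm
  have h0 : 0 ≤ ∫ s in (-D.τ)..0, (‖x s‖ - m / D.τ) ^ 2 :=
    intervalIntegral.integral_nonneg (by linarith) fun s _ => sq_nonneg _
  have h1 : ∫ s in (-D.τ)..0, (‖x s‖ - m / D.τ) ^ 2 =
      (∫ s in (-D.τ)..0, ‖x s‖ ^ 2) - m ^ 2 / D.τ := by
    have e : ∀ s, (‖x s‖ - m / D.τ) ^ 2 =
        ‖x s‖ ^ 2 - 2 * (m / D.τ) * ‖x s‖ + (m / D.τ) ^ 2 := fun s => by ring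
    simp only [e]
    rw [intervalIntegral.integral_add, intervalIntegral.integral_sub,
      intervalIntegral.integral_const_mul, ← hm, intervalIntegral.integral_const]
    · simp only [smul_eq_mul]
      field_simp
      ring
    all_goals exact Continuous.intervalIntegrable (by fun_prop) _ _
  rw [h1, sub_nonneg, div_le_iff₀ hτ] at h0
  linarith

theorem denseRange_incl : DenseRange D.incl :=
  ContinuousMap.toLp_denseRange X D.μ ℝ (by norm_num)

variable [CompleteSpace X]

theorem isSolution_of_picard {p : P} {ψ : C(Icc (-D.τ) 0, X)}
    {x : C(ℝ, X)} (h : D.picard p ψ x = x) : D.IsSolution p ψ x where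
  initial θ := by
    rw [← h]
    simp [picard, max_eq_right θ.2.2]
  hasDeriv t ht := by
    have h1 : HasDerivAt (fun t => ψ ⟨0, D.zero_mem⟩ +
        ∫ s in (0 : ℝ)..t, D.rhs p s (D.hist x s)) (D.rhs p t (D.hist x t)) t :=
      ((D.continuous_rhs_hist p x).integral_hasStrictDerivAt 0 t).hasDerivAt.const_add _
    have h2 : ∀ s ∈ Ici (0 : ℝ), x s = ψ ⟨0, D.zero_mem⟩ +
        ∫ r in (0 : ℝ)..s, D.rhs p r (D.hist x r) := fun s hs => by
      conv_lhs => rw [← h]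
      simp [picard, max_eq_left (mem_Ici.1 hs), projIcc_of_right_le _ (mem_Ici.1 hs)]
    exact h1.hasDerivWithinAt.congr h2 (h2 t ht)

theorem exists_isSolution (p : P) (ψ : C(Icc (-D.τ) 0, X)) :
    ∃ x, D.IsSolution p ψ x := by
  obtain ⟨K, hK, hrhs⟩ := D.exists_norm_rhs_le
  have hp := hrhs p
  let w : ℝ → ℝ := fun t => Real.exp (2 * K * max t 0)
  have hw : ∀ t, 0 < w t := fun t => Real.exp_pos _
  have hw1 : ∀ t, 1 ≤ w t := fun t => Real.one_le_exp (by positivity)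
  have hwc : Continuous w := by fun_prop
  have hwc' : Continuous fun t => (w t)⁻¹ := hwc.inv₀ fun t => (hw t).ne'
  let un : BoundedContinuousFunction ℝ X →
      C(ℝ, X) := fun y => ⟨fun t => w t • y t, by fun_prop⟩
  have hun : ∀ y t, ‖un y t‖ ≤ ‖y‖ * w t := fun y t => by
    simp only [un, ContinuousMap.coe_mk, norm_smul, Real.norm_of_nonneg (hw t).le]
    rw [mul_comm]
    gcongr
    exact y.norm_coe_le_norm t
  let T : BoundedContinuousFunction ℝ X →
      BoundedContinuousFunction ℝ X := fun y =>
    BoundedContinuousFunction.ofNormedAddCommGroup (fun t => (w t)⁻¹ • D.picard p ψ (un y) t)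
      (by fun_prop) (‖ψ‖ + ‖y‖ / 2) (fun t => by
        rw [norm_smul, norm_inv, Real.norm_of_nonneg (hw t).le, inv_mul_le_iff₀ (hw t)]
        refine (norm_add_le _ _).trans ?_
        have h1 := D.norm_integral_rhs_le hK p hp (un y) (norm_nonneg y) (hun y) t
        have h2 := ψ.norm_coe_le_norm (projIcc (-D.τ) 0 (by linarith [D.τ_pos]) t)
        have h3 : ‖ψ‖ ≤ w t * ‖ψ‖ := le_mul_of_one_le_left (norm_nonneg _) (hw1 t)
        have h4 : ‖y‖ / 2 * Real.exp (2 * K * max t 0) = w t * (‖y‖ / 2) := mul_comm _ _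
        linarith)
  have hT : ContractingWith (1 / 2) T := by
    refine ⟨by norm_num, LipschitzWith.of_dist_le_mul fun y z => ?_⟩
    rw [dist_eq_norm, dist_eq_norm, BoundedContinuousFunction.norm_le (by positivity)]
    intro t
    have e : (T y - T z) t = (w t)⁻¹ •
        ∫ s in (0 : ℝ)..max t 0, D.rhs p s (D.hist (un (y - z)) s) := by
      have e1 : ∀ s, D.rhs p s (D.hist (un (y - z)) s) =
          D.rhs p s (D.hist (un y) s) - D.rhs p s (D.hist (un z) s) := fun s => by
        rw [← map_sub, ← hist_sub]
        congr 2
        ext1 t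
        simp [un, smul_sub]
      simp only [e1]
      rw [intervalIntegral.integral_sub
        ((D.continuous_rhs_hist p _).intervalIntegrable _ _)
        ((D.continuous_rhs_hist p _).intervalIntegrable _ _)]
      simp [T, picard, smul_sub, smul_add]
    rw [e, norm_smul, norm_inv, Real.norm_of_nonneg (hw t).le, inv_mul_le_iff₀ (hw t)]
    have h1 := D.norm_integral_rhs_le hK p hp (un (y - z)) (norm_nonneg _) (hun _) t
    refine h1.trans (le_of_eq ?_)
    simp [w]
    ring
  refine ⟨un (hT.fixedPoint T), D.isSolution_of_picard ?_⟩
  ext1 t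
  have h' : w t • (w t)⁻¹ • D.picard p ψ (un (hT.fixedPoint T)) t =
      w t • (hT.fixedPoint T) t := congrArg (fun y => w t • y t) hT.fixedPoint_isFixedPt
  rw [smul_smul, mul_inv_cancel₀ (hw t).ne', one_smul] at h'
  exact h'

theorem integral_functional_le (q : C(Icc (-D.τ) 0, X) →L[ℝ] ℝ)
    (x : C(ℝ, X)) {t : ℝ} (ht : 0 ≤ t) :
    ∫ s in (0 : ℝ)..t, |q (D.hist x s)| ≤ ‖q‖ * ∫ s in (-D.τ)..t, ‖x s‖ := by
  have hq : Continuous fun s => q (D.hist x s) := q.continuous.comp (D.continuous_hist x)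
  let g : ℝ → ℝ := fun s => if 0 ≤ q (D.hist x s) then 1 else -1
  have hg : Measurable g := Measurable.ite (measurableSet_le measurable_const hq.measurable)
    measurable_const measurable_const
  have hg1 : ∀ s, ‖g s‖ ≤ 1 := fun s => by
    by_cases h : 0 ≤ q (D.hist x s) <;> simp [g, h]
  have hint : IntervalIntegrable (fun s => g s • D.hist x s) volume 0 t := by
    have h0 := (D.continuous_hist x).intervalIntegrable (μ := volume) 0 t
    rw [intervalIntegrable_iff] at h0 ⊢
    exact h0.bdd_smul 1 hg.aestronglyMeasurable (Filter.Eventually.of_forall hg1)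
  have h1 : ∫ s in (0 : ℝ)..t, |q (D.hist x s)| = q (∫ s in (0 : ℝ)..t, g s • D.hist x s) := by
    rw [← ContinuousLinearMap.intervalIntegral_comp_comm q hint]
    refine intervalIntegral.integral_congr fun s _ => ?_
    by_cases h : 0 ≤ q (D.hist x s)
    · simp [g, h, abs_of_nonneg]
    · simp [g, h, abs_of_neg (not_le.1 h)]
  rw [h1]
  refine (le_abs_self _).trans ((q.le_opNorm _).trans ?_)
  have hxn : Continuous fun s => ‖x s‖ := by fun_prop
  gcongr
  refine (ContinuousMap.norm_le _ (intervalIntegral.integral_nonneg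
    (by linarith [D.τ_pos]) fun s _ => norm_nonneg _)).2 fun θ => ?_
  have h2 := ContinuousLinearMap.intervalIntegral_comp_comm
    (ContinuousMap.evalCLM ℝ θ : C(Icc (-D.τ) 0, X) →L[ℝ] _) hint
  change ‖ContinuousMap.evalCLM ℝ θ (∫ s in (0 : ℝ)..t, g s • D.hist x s)‖ ≤ _
  rw [← h2]
  calc ‖∫ s in (0 : ℝ)..t, ContinuousMap.evalCLM ℝ θ (g s • D.hist x s)‖
      ≤ ∫ s in (0 : ℝ)..t, ‖x (s + θ)‖ := by
        refine intervalIntegral.norm_integral_le_of_norm_le ht ?_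
          (Continuous.intervalIntegrable (by fun_prop) _ _)
        refine Filter.Eventually.of_forall fun s _ => ?_
        change ‖g s • x (s + θ)‖ ≤ _
        rw [norm_smul]
        exact mul_le_of_le_one_left (norm_nonneg _) (hg1 s)
    _ = ∫ s in (0 + (θ : ℝ))..(t + θ), ‖x s‖ :=
        intervalIntegral.integral_comp_add_right (fun s => ‖x s‖) _
    _ ≤ _ := by
        have := θ.2.1
        have := θ.2.2
        exact intervalIntegral.integral_mono_interval (by linarith) (by linarith) (by linarith)
          (Filter.Eventually.of_forall fun s => norm_nonneg _) (hxn.intervalIntegrable _ _)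

theorem integral_operator_le {W : Type*} [NormedAddCommGroup W] [InnerProductSpace ℝ W]
    [FiniteDimensional ℝ W] (Q : C(Icc (-D.τ) 0, X) →L[ℝ] W) :
    ∃ c : ℝ, 0 ≤ c ∧ ∀ (x : C(ℝ, X)) (t : ℝ), 0 ≤ t →
      ∫ s in (0 : ℝ)..t, ‖Q (D.hist x s)‖ ≤ c * ∫ s in (-D.τ)..t, ‖x s‖ := by
  let b := stdOrthonormalBasis ℝ W
  refine ⟨∑ i, ‖innerSL ℝ (b i) ∘L Q‖, by positivity,
    fun x t ht => ?_⟩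
  have hQ : Continuous fun s => Q (D.hist x s) := Q.continuous.comp (D.continuous_hist x)
  have hi : ∀ i, Continuous fun s => |(innerSL ℝ (b i) ∘L Q) (D.hist x s)| := fun i =>
    ((innerSL ℝ (b i) ∘L Q).continuous.comp (D.continuous_hist x)).abs
  calc ∫ s in (0 : ℝ)..t, ‖Q (D.hist x s)‖
      ≤ ∫ s in (0 : ℝ)..t, ∑ i, |(innerSL ℝ (b i) ∘L Q) (D.hist x s)| := by
        refine intervalIntegral.integral_mono_on ht (hQ.norm.intervalIntegrable _ _)
          ((continuous_finsetSum _ fun i _ => hi i).intervalIntegrable _ _) fun s _ => ?_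
        conv_lhs => rw [← b.sum_repr' (Q (D.hist x s))]
        refine (norm_sum_le _ _).trans (Finset.sum_le_sum fun i _ => ?_)
        simp [norm_smul]
    _ = ∑ i, ∫ s in (0 : ℝ)..t, |(innerSL ℝ (b i) ∘L Q) (D.hist x s)| :=
        intervalIntegral.integral_finsetSum fun i _ => (hi i).intervalIntegrable _ _
    _ ≤ _ := by
        rw [Finset.sum_mul]
        exact Finset.sum_le_sum fun i _ => D.integral_functional_le _ x ht

theorem IsSolution.sub_eq {D : DelaySystem P M U X} {p : P} {ψ : C(Icc (-D.τ) 0, X)}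
    {x : C(ℝ, X)} (hx : D.IsSolution p ψ x) {t : ℝ} (ht : 0 ≤ t) :
    ∫ s in (0 : ℝ)..t, D.rhs p s (D.hist x s) = x t - x 0 :=
  intervalIntegral.integral_eq_sub_of_hasDeriv_right_of_le ht x.continuous.continuousOn
    (fun s hs => (hx.hasDeriv s hs.1.le).mono (Ioi_subset_Ici hs.1.le))
    ((D.continuous_rhs_hist p x).intervalIntegrable _ _)

theorem exists_norm_le_add [FiniteDimensional ℝ X] [FiniteDimensional ℝ M] :
    ∃ c : ℝ, 0 < c ∧ ∀ (p : P) (ψ : C(Icc (-D.τ) 0, X)) (x : C(ℝ, X)), D.IsSolution p ψ x →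
      ∀ s, 0 ≤ s → ‖x s‖ ≤ ‖x 0‖ + c * ∫ r in (-D.τ)..s, ‖x r‖ := by
  obtain ⟨c₁, hc₁, h₁⟩ := D.integral_operator_le D.A
  obtain ⟨c₂, hc₂, h₂⟩ := D.integral_operator_le D.C
  have hτ := D.τ_pos
  have hΛ := D.Λ_pos
  refine ⟨c₁ + ‖D.B‖ * D.Λ * c₂ + 1, by positivity, fun p ψ x hx s hs => ?_⟩
  set m := ∫ r in (-D.τ)..s, ‖x r‖
  have h8 : 0 ≤ m := intervalIntegral.integral_nonneg (by linarith) fun s _ => norm_nonneg _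
  have hA : Continuous fun r => D.A (D.hist x r) := D.A.continuous.comp (D.continuous_hist x)
  have hC : Continuous fun r => D.C (D.hist x r) := D.C.continuous.comp (D.continuous_hist x)
  have h3 : ‖∫ r in (0 : ℝ)..s, D.rhs p r (D.hist x r)‖ ≤
      ∫ r in (0 : ℝ)..s, (‖D.A (D.hist x r)‖ + ‖D.B‖ * D.Λ * ‖D.C (D.hist x r)‖) := by
    refine intervalIntegral.norm_integral_le_of_norm_le hs ?_
      (Continuous.intervalIntegrable (by fun_prop) _ _)
    refine Filter.Eventually.of_forall fun r _ => ?_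
    refine (norm_add_le _ _).trans (add_le_add le_rfl ?_)
    refine (D.B.le_opNorm _).trans ?_
    rw [mul_assoc]
    refine mul_le_mul_of_nonneg_left ?_ (norm_nonneg _)
    exact ((D.F' _).le_opNorm _).trans
      (mul_le_mul_of_nonneg_right (D.norm_F'_le _) (norm_nonneg _))
  rw [intervalIntegral.integral_add (hA.norm.intervalIntegrable _ _)
    (Continuous.intervalIntegrable (by fun_prop) _ _), intervalIntegral.integral_const_mul,
    hx.sub_eq hs] at h3
  have h4 := h₁ x s hs
  have h6 : ‖x s‖ ≤ ‖x s - x 0‖ + ‖x 0‖ := by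
    simpa using norm_add_le (x s - x 0) (x 0)
  have h7 : ‖D.B‖ * D.Λ * ∫ r in (0 : ℝ)..s, ‖D.C (D.hist x r)‖ ≤
      ‖D.B‖ * D.Λ * (c₂ * m) :=
    mul_le_mul_of_nonneg_left (h₂ x s hs) (by positivity)
  have h9 : (c₁ + ‖D.B‖ * D.Λ * c₂ + 1) * m =
      c₁ * m + ‖D.B‖ * D.Λ * (c₂ * m) + m := by ring
  linarith

/-- Solutions are bounded in the norm of `L₂([-τ, 0]; μ; X)` through their initial functions. -/
theorem exists_norm_incl_hist_le [FiniteDimensional ℝ X] [FiniteDimensional ℝ M] (T : ℝ) :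
    ∃ K : ℝ, ∀ (p : P) (ψ : C(Icc (-D.τ) 0, X)) (x : C(ℝ, X)), D.IsSolution p ψ x →
      ∀ t ∈ Icc 0 T, ‖D.incl (D.hist x t)‖ ≤ K * ‖D.incl ψ‖ := by
  obtain ⟨c, hc, hx'⟩ := D.exists_norm_le_add
  have hτ := D.τ_pos
  let b := (√D.τ + 1) * Real.exp (c * |T|) * (1 + 1 / c) * c + 1
  have hb : 0 ≤ b := by positivity
  refine ⟨√(b ^ 2 + 1 + |T| * b ^ 2), fun p ψ x hx t ht => ?_⟩
  have hxb0 := hx' p ψ x hx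
  set a := ‖D.incl ψ‖ with ha
  have ha0 : 0 ≤ a := norm_nonneg _
  have hxc : Continuous fun s => ‖x s‖ := by fun_prop
  have hxc2 : Continuous fun s => ‖x s‖ ^ 2 := by fun_prop
  have hψ : (∫ s in (-D.τ)..0, ‖x s‖ ^ 2) + ‖x 0‖ ^ 2 = a ^ 2 := by
    have := D.norm_sq_incl_hist x 0
    rw [hx.hist_zero] at this
    simpa using this.symm
  have hI0 : 0 ≤ ∫ s in (-D.τ)..0, ‖x s‖ ^ 2 :=
    intervalIntegral.integral_nonneg (by linarith) fun s _ => sq_nonneg _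
  have hx0 : ‖x 0‖ ≤ a := le_of_sq_le_sq (by linarith) ha0
  let m : ℝ → ℝ := fun s => ∫ r in (-D.τ)..s, ‖x r‖
  have hm0 : ∀ s, -D.τ ≤ s → 0 ≤ m s := fun s hs =>
    intervalIntegral.integral_nonneg hs fun s _ => norm_nonneg _
  have hmi : m 0 ≤ √D.τ * a := by
    refine le_of_sq_le_sq ?_ (by positivity)
    rw [mul_pow, Real.sq_sqrt hτ.le]
    refine (D.sq_integral_norm_le x).trans ?_
    gcongr
    nlinarith [sq_nonneg ‖x 0‖]
  have hxm : ∀ s, 0 ≤ s → ‖x s‖ ≤ a + c * m s := fun s hs => by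
    exact (hxb0 s hs).trans (add_le_add hx0 le_rfl)
  have hder : ∀ s, HasDerivAt m ‖x s‖ s := fun s =>
    (hxc.integral_hasStrictDerivAt (-D.τ) s).hasDerivAt
  have hgr : ∀ s ∈ Icc 0 t, m s ≤ (√D.τ + 1) * Real.exp (c * |T|) * (1 + 1 / c) * a := by
    intro s hs
    have h := norm_le_gronwallBound_of_norm_deriv_right_le (f := m) (f' := fun s => ‖x s‖)
      (δ := (√D.τ + 1) * a) (K := c) (ε := (√D.τ + 1) * a) (a := 0) (b := t)
      (fun s _ => (hder s).continuousAt.continuousWithinAt)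
      (fun s _ => (hder s).hasDerivWithinAt)
      (by
        rw [Real.norm_of_nonneg (hm0 0 (by linarith))]
        linarith)
      (fun s hs => by
        rw [norm_norm, Real.norm_of_nonneg (hm0 s (by linarith [hs.1]))]
        have := hxm s hs.1
        have : 0 ≤ √D.τ * a := by positivity
        linarith) s hs
    rw [Real.norm_of_nonneg (hm0 s (by linarith [hs.1])), gronwallBound_of_K_ne_0 hc.ne',
      sub_zero] at h
    have hexp : Real.exp (c * s) ≤ Real.exp (c * |T|) := by
      gcongr
      exact (hs.2.trans ht.2).trans (le_abs_self T)
    have h10 : (√D.τ + 1) * a * Real.exp (c * s) + (√D.τ + 1) * a / c * (Real.exp (c * s) - 1) ≤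
        (√D.τ + 1) * a * Real.exp (c * |T|) + (√D.τ + 1) * a / c * Real.exp (c * |T|) := by
      gcongr
      linarith
    refine h.trans (h10.trans (le_of_eq ?_))
    ring
  have hxb : ∀ s ∈ Icc 0 t, ‖x s‖ ≤ b * a := fun s hs => by
    have h1 := hxm s hs.1
    have h2 : c * m s ≤ c * ((√D.τ + 1) * Real.exp (c * |T|) * (1 + 1 / c) * a) := by
      gcongr
      exact hgr s hs
    refine h1.trans ((add_le_add_right h2 a).trans (le_of_eq ?_))
    simp only [b]
    ring
  refine le_of_sq_le_sq ?_ (by positivity)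
  rw [D.norm_sq_incl_hist, mul_pow, Real.sq_sqrt (by positivity)]
  have hi1 : ∫ s in (t - D.τ)..t, ‖x s‖ ^ 2 ≤ ∫ s in (-D.τ)..t, ‖x s‖ ^ 2 :=
    intervalIntegral.integral_mono_interval (by linarith [ht.1]) (by linarith) le_rfl
      (Filter.Eventually.of_forall fun s => sq_nonneg _) (hxc2.intervalIntegrable _ _)
  have hi2 := intervalIntegral.integral_add_adjacent_intervals (μ := volume)
    (hxc2.intervalIntegrable (-D.τ) 0) (hxc2.intervalIntegrable 0 t)
  have hi3 : ∫ s in (0 : ℝ)..t, ‖x s‖ ^ 2 ≤ ∫ s in (0 : ℝ)..t, (b * a) ^ 2 :=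
    intervalIntegral.integral_mono_on ht.1 (hxc2.intervalIntegrable _ _)
      (Continuous.intervalIntegrable (by fun_prop) _ _) fun s hs => by
        gcongr
        exact hxb s hs
  rw [intervalIntegral.integral_const, smul_eq_mul, sub_zero] at hi3
  have hi4 : t * (b * a) ^ 2 ≤ |T| * (b * a) ^ 2 := by
    gcongr
    exact ht.2.trans (le_abs_self T)
  have hi5 : ‖x t‖ ^ 2 ≤ (b * a) ^ 2 := by
    gcongr
    exact hxb t ⟨ht.1, le_rfl⟩
  nlinarith [sq_nonneg ‖x 0‖]

/-- Well-posedness of the delay equation in `L₂([-τ, 0]; μ; X)`. -/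
theorem existsUnique_solutionOperator [FiniteDimensional ℝ X] [FiniteDimensional ℝ M]
    (t : ℝ≥0) (p : P) :
    ∃! G : D.H →L[ℝ] D.H, ∀ (ψ : C(Icc (-D.τ) 0, X)) (x : C(ℝ, X)), D.IsSolution p ψ x →
      G (D.incl ψ) = D.incl (D.hist x t) := by
  obtain ⟨K, hK⟩ := D.exists_norm_incl_hist_le t
  have hK' := fun ψ x hx => hK p ψ x hx t ⟨t.2, le_rfl⟩
  choose S hS using D.exists_isSolution p
  have huniq : ∀ ψ x y, D.IsSolution p ψ x → D.IsSolution p ψ y →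
      D.incl (D.hist x t) = D.incl (D.hist y t) := fun ψ x y hx hy => by
    have h := hK' _ _ (hx.add (hy.smul (-1)))
    rw [hist_add, hist_smul] at h
    simp only [neg_smul, one_smul, add_neg_cancel, map_zero, norm_zero, mul_zero] at h
    rw [← sub_eq_add_neg, map_sub] at h
    exact sub_eq_zero.1 (norm_le_zero_iff.1 h)
  let S' : C(Icc (-D.τ) 0, X) →ₗ[ℝ] D.H :=
    { toFun := fun ψ => D.incl (D.hist (S ψ) t)
      map_add' := fun ψ φ => by
        rw [← map_add, ← hist_add]
        exact huniq _ _ _ (hS _) ((hS ψ).add (hS φ))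
      map_smul' := fun c ψ => by
        rw [RingHom.id_apply, ← map_smul, ← hist_smul]
        exact huniq _ _ _ (hS _) ((hS ψ).smul c) }
  have hd : DenseRange (D.incl : C(Icc (-D.τ) 0, X) →ₗ[ℝ] D.H) := D.denseRange_incl
  refine ⟨S'.extendOfNorm (D.incl : C(Icc (-D.τ) 0, X) →ₗ[ℝ] D.H), fun ψ x hx => ?_,
    fun G hG => ?_⟩
  · have h := LinearMap.extendOfNorm_eq (f := S')
      (e := (D.incl : C(Icc (-D.τ) 0, X) →ₗ[ℝ] D.H)) hd ⟨K, fun ψ => hK' _ _ (hS ψ)⟩ ψ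
    exact h.trans (huniq _ _ _ (hS ψ) hx)
  · refine (LinearMap.extendOfNorm_unique hd K (fun ψ => hK' _ _ (hS ψ)) G ?_).symm
    ext1 ψ
    exact hG ψ _ (hS ψ)

/-- The linear cocycle `Ξ^t(℘, ·)` generated by the delay equation in `L₂([-τ, 0]; μ; X)`: the
bounded operator sending the (image of the) initial function `ψ ∈ C([-τ, 0]; X)` of a solution
`x` over `℘` to the history segment `x_t`. By `existsUnique_solutionOperator` there is exactly one
such operator. -/
def cocycle [FiniteDimensional ℝ X] [FiniteDimensional ℝ M] (t : ℝ≥0) (p : P) :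
    D.H →L[ℝ] D.H :=
  (D.existsUnique_solutionOperator t p).choose

theorem cocycle_incl [FiniteDimensional ℝ X] [FiniteDimensional ℝ M] (t : ℝ≥0) {p : P}
    {ψ : C(Icc (-D.τ) 0, X)} {x : C(ℝ, X)} (hx : D.IsSolution p ψ x) :
    D.cocycle t p (D.incl ψ) = D.incl (D.hist x t) :=
  (D.existsUnique_solutionOperator t p).choose_spec.1 ψ x hx

/-- The `m`-fold multiplicative compound `Ξ_m` of the cocycle `Ξ` in the exterior power `H^{∧ m}`
of `H = L₂([-τ, 0]; μ; X)`. -/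
def compoundCocycle [FiniteDimensional ℝ X] [FiniteDimensional ℝ M] (m : ℕ) (t : ℝ≥0) (p : P) :
    ExtPow D.H m →L[ℝ] ExtPow D.H m :=
  extMap m (D.cocycle t p)

end DelaySystem

/-- A family of operators `Ψ^t(p, ·)` (a linear cocycle) is uniformly exponentially stable with the
exponent `ν > 0`. -/
def IsUniformlyExponentiallyStable {P V : Type*} [NormedAddCommGroup V] [NormedSpace ℝ V]
    (Ψ : ℝ≥0 → P → V →L[ℝ] V) (ν : ℝ) : Prop :=
  0 < ν ∧ ∃ K : ℝ, 0 < K ∧ ∀ (t : ℝ≥0) (p : P) (v : V),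
    ‖Ψ t p v‖ ≤ K * Real.exp (-ν * t) * ‖v‖

end Delay

end DelayCompound

end

/-!
The proof compares a pointwise value with an integral. Put
`w s = exp (2 ν₀ s) ‖Ξ_m^s (℘, Φ)‖²`. Since `V ≥ 0`, the hypothesis gives
`δ ∫₀ᵗ w ≤ V Φ ≤ ‖Q‖ ‖Φ‖²` for all `t`. By the cocycle property
`Ξ_m^t (℘) = Ξ_m^{t-s} (π^s ℘) Ξ_m^s (℘)` and a bound on `Ξ_m^r` that is uniform in `r ∈ [0, 1]` and
in `℘`, one has `w t ≤ C w s` for all `s ∈ [t - 1, t]`; integrating over `s ∈ [t - 1, t]` yields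
`w t ≤ C ‖Q‖ ‖Φ‖² / δ` for `t ≥ 1`, while for `t ≤ 1` the uniform bound suffices. This abstract
argument is `exists_bound_of_integral_le`.

The inputs are the cocycle property (`DelaySystem.cocycle_add`), which holds because shifted
solutions are solutions over the shifted base point; the bound on compact time intervals
(`DelaySystem.exists_norm_cocycle_le`), which extends from continuous initial functions by density;
and the strong continuity of `Ξ_m`. The last one is essential: it makes `w` integrable, without
which the integral in the hypothesis would be zero by convention. It is proved first for
continuous initial functions, then for `H` by density (`continuous_apply_of_dense`), then for
decomposable tensors by the continuity of `tmul`, and for `H^{⊗ m}` by density again.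
-/

noncomputable section

namespace DelayCompound

open scoped TensorProduct Matrix NNReal Topology
open MeasureTheory Set Filter

/-! ### Strong continuity and an abstract stability criterion -/

/-- A locally bounded family of operators that is strongly continuous on the range of a map with
dense range is strongly continuous. -/
theorem continuous_apply_of_dense {α ι E F : Type*} [TopologicalSpace α]
    [NormedAddCommGroup E] [NormedSpace ℝ E] [NormedAddCommGroup F] [NormedSpace ℝ F]
    {T : α → E →L[ℝ] F} (hT : ∀ a, ∃ C, ∀ᶠ b in 𝓝 a, ‖T b‖ ≤ C)
    {e : ι → E} (he : DenseRange e) (hc : ∀ i, Continuous fun a => T a (e i)) (x : E) :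
    Continuous fun a => T a x := by
  refine continuous_iff_continuousAt.2 fun a => Metric.tendsto_nhds.2 fun ε hε => ?_
  obtain ⟨C, hC⟩ := hT a
  have hC0 : 0 ≤ C := (norm_nonneg _).trans hC.self_of_nhds
  obtain ⟨i, hi⟩ := Metric.denseRange_iff.1 he x (ε / (3 * (C + 1))) (by positivity)
  have happrox : ∀ b, ‖T b‖ ≤ C → dist (T b x) (T b (e i)) < ε / 3 := fun b hb => by
    rw [dist_eq_norm, ← map_sub]
    calc ‖T b (x - e i)‖ ≤ C * ‖x - e i‖ := (T b).le_of_opNorm_le hb _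
      _ ≤ (C + 1) * ‖x - e i‖ := by gcongr; linarith
      _ < (C + 1) * (ε / (3 * (C + 1))) := by
        rw [← dist_eq_norm]
        gcongr
      _ = ε / 3 := by field_simp
  filter_upwards [hC, Metric.tendsto_nhds.1 (hc i).continuousAt (ε / 3) (by positivity)]
    with b hb hb'
  have h1 := happrox b hb
  have h2 := happrox a hC.self_of_nhds
  rw [dist_comm] at h2
  have h3 := dist_triangle4 (T b x) (T b (e i)) (T a (e i)) (T a x)
  linarith

/-- A strongly continuous linear cocycle that is uniformly bounded on the time interval `[0, 1]` and
has square-integrable trajectories, with weight `exp (2 ν s)` and a uniform bound on the integral,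
decays with the exponent `ν`. -/
theorem exists_bound_of_integral_le {P E : Type*} [NormedAddCommGroup E]
    [NormedSpace ℝ E] (Ψ : ℝ≥0 → P → E →L[ℝ] E) (flow : ℝ≥0 → P → P)
    (hΨ : ∀ s t p, Ψ (s + t) p = Ψ s (flow t p) ∘L Ψ t p)
    (hcont : ∀ p v, Continuous fun t => Ψ t p v)
    {L : ℝ} (hL : ∀ t : ℝ≥0, t ≤ 1 → ∀ p, ‖Ψ t p‖ ≤ L) {ν c : ℝ}
    (hint : ∀ (t : ℝ≥0) p v, ∫ s in (0 : ℝ)..t, Real.exp (2 * ν * s) * ‖Ψ s.toNNReal p v‖ ^ 2 ≤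
      c * ‖v‖ ^ 2) :
    ∃ K : ℝ, 0 < K ∧ ∀ v p (t : ℝ≥0), ‖Ψ t p v‖ ≤ K * Real.exp (-ν * t) * ‖v‖ := by
  let b := Real.exp |ν| * |L|
  have hb : 0 ≤ b := by positivity
  -- `exp (ν r) ‖Ψ r‖ ≤ b` for `r ∈ [0, 1]`
  have hstep : ∀ (r : ℝ≥0), r ≤ 1 → ∀ p v, Real.exp (ν * r) * ‖Ψ r p v‖ ≤ b * ‖v‖ := by
    intro r hr p v
    have hr' : (r : ℝ) ≤ 1 := hr
    have h1 : Real.exp (ν * r) ≤ Real.exp |ν| := by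
      refine Real.exp_le_exp.2 ((le_abs_self _).trans ?_)
      rw [abs_mul, NNReal.abs_eq]
      exact mul_le_of_le_one_right (abs_nonneg _) hr'
    have h2 : ‖Ψ r p v‖ ≤ |L| * ‖v‖ :=
      (Ψ r p).le_of_opNorm_le ((hL r hr p).trans (le_abs_self L)) v
    calc Real.exp (ν * r) * ‖Ψ r p v‖ ≤ Real.exp |ν| * (|L| * ‖v‖) := by gcongr
      _ = b * ‖v‖ := by ring
  have hmain : ∀ v p (t : ℝ≥0), Real.exp (ν * t) * ‖Ψ t p v‖ ≤ (b + b * √|c| + 1) * ‖v‖ := by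
    intro v p t
    rcases le_total t 1 with ht | ht
    · refine (hstep t ht p v).trans ?_
      gcongr
      have : 0 ≤ b * √|c| := by positivity
      linarith
    · have ht' : (1 : ℝ) ≤ t := ht
      let w : ℝ → ℝ := fun s => Real.exp (2 * ν * s) * ‖Ψ s.toNNReal p v‖ ^ 2
      have hw : Continuous w := by
        have := (hcont p v).comp continuous_real_toNNReal
        exact (by fun_prop : Continuous fun s : ℝ => Real.exp (2 * ν * s)).mul (this.norm.pow 2)
      have hw0 : ∀ s, 0 ≤ w s := fun s => by positivity
      have hwt : ∀ s ∈ Icc ((t : ℝ) - 1) t,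
          (Real.exp (ν * t) * ‖Ψ t p v‖) ^ 2 ≤ b ^ 2 * w s := by
        intro s hs
        have hs0 : 0 ≤ s := by linarith [hs.1]
        lift s to ℝ≥0 using hs0
        have hst : s ≤ t := hs.2
        obtain ⟨r, rfl⟩ := exists_add_of_le hst
        have hr : r ≤ 1 := by
          have := hs.1
          push_cast at this
          exact_mod_cast (by linarith : (r : ℝ) ≤ 1)
        have h := hstep r hr (flow s p) (Ψ s p v)
        have e : Real.exp (ν * (s + r : ℝ≥0)) * ‖Ψ (s + r) p v‖ =
            Real.exp (ν * s) * (Real.exp (ν * r) * ‖Ψ r (flow s p) (Ψ s p v)‖) := by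
          rw [add_comm s r, hΨ, ContinuousLinearMap.comp_apply, NNReal.coe_add, mul_add,
            Real.exp_add]
          ring
        have e2 : w s = (Real.exp (ν * s) * ‖Ψ s p v‖) ^ 2 := by
          simp only [w, Real.toNNReal_coe]
          rw [mul_pow, ← Real.exp_nat_mul]
          congr 2
          push_cast
          ring
        rw [e, e2, ← mul_pow]
        refine pow_le_pow_left₀ (by positivity) ?_ 2
        calc _ ≤ Real.exp (ν * s) * (b * ‖Ψ s p v‖) := by gcongr
          _ = _ := by ring
      have h1 : (Real.exp (ν * t) * ‖Ψ t p v‖) ^ 2 ≤ b ^ 2 * ∫ s in ((t : ℝ) - 1)..t, w s := by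
        have h := intervalIntegral.integral_mono_on (μ := volume) (by linarith)
          (continuous_const.intervalIntegrable ((t : ℝ) - 1) t)
          ((continuous_const.mul hw).intervalIntegrable _ _) hwt
        simpa using h
      have h2 : ∫ s in ((t : ℝ) - 1)..t, w s ≤ ∫ s in (0 : ℝ)..t, w s :=
        intervalIntegral.integral_mono_interval (by linarith) (by linarith) le_rfl
          (Eventually.of_forall hw0) (hw.intervalIntegrable _ _)
      have h3 : (Real.exp (ν * t) * ‖Ψ t p v‖) ^ 2 ≤ (b * √|c| * ‖v‖) ^ 2 := by
        calc _ ≤ b ^ 2 * (|c| * ‖v‖ ^ 2) := h1.trans (by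
              gcongr
              refine (h2.trans (hint t p v)).trans ?_
              gcongr
              exact le_abs_self c)
          _ = _ := by rw [mul_pow (b * √|c|), mul_pow b √|c|, Real.sq_sqrt (abs_nonneg c)]; ring
      refine (le_of_sq_le_sq h3 (by positivity)).trans ?_
      gcongr
      linarith
  refine ⟨b + b * √|c| + 1, by positivity, fun v p t => ?_⟩
  have h := hmain v p t
  rw [neg_mul, Real.exp_neg, mul_right_comm, ← div_eq_mul_inv, le_div_iff₀ (Real.exp_pos _),
    mul_comm]
  exact h

/-! ### Compound operators -/

section Tensor

variable {H : Type*} [NormedAddCommGroup H] [InnerProductSpace ℝ H] {m : ℕ}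

theorem norm_tensorMap_le (G : H →L[ℝ] H) : ‖tensorMap m G‖ ≤ ‖G‖ ^ m := by
  refine ContinuousLinearMap.opNorm_le_bound _ (by positivity) fun x => ?_
  induction x using UniformSpace.Completion.induction_on with
  | hp => exact isClosed_le (by fun_prop) (by fun_prop)
  | ih x =>
    have h := innerForm_algMap_le (m := m) G x
    rw [← norm_sq_alg, ← norm_sq_alg, ← mul_pow] at h
    simpa [tensorMap] using le_of_sq_le_sq h (by positivity)

theorem norm_extMap_le (G : H →L[ℝ] H) : ‖extMap m G‖ ≤ ‖G‖ ^ m :=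
  ContinuousLinearMap.opNorm_le_bound _ (by positivity) fun x =>
    (tensorMap m G).le_of_opNorm_le (norm_tensorMap_le G) x

theorem tensorMap_comp (G₁ G₂ : H →L[ℝ] H) (x : TensorPow H m) :
    tensorMap m (G₁ ∘L G₂) x = tensorMap m G₁ (tensorMap m G₂ x) := by
  induction x using UniformSpace.Completion.induction_on with
  | hp => exact isClosed_eq (by fun_prop) (by fun_prop)
  | ih x =>
    have : algMap (G₁ ∘L G₂) = algMap G₁ ∘ₗ (algMap G₂ : AlgTensor H m →ₗ[ℝ] _) :=
      alg_ext fun v => by simp [algMap_tmul]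
    have h : algMap (G₁ ∘L G₂) x = algMap G₁ (algMap G₂ x) := congr($this x)
    simp [tensorMap, h]

theorem extMap_comp (G₁ G₂ : H →L[ℝ] H) : extMap m (G₁ ∘L G₂) = extMap m G₁ ∘L extMap m G₂ :=
  ContinuousLinearMap.ext fun x => Subtype.ext (tensorMap_comp G₁ G₂ (x : TensorPow H m))

theorem continuous_tmul : Continuous (tmul : (Fin m → H) → AlgTensor H m) := by
  refine continuous_iff_continuousAt.2 fun v => tendsto_iff_norm_sub_tendsto_zero.2 ?_
  have e : ∀ w : Fin m → H, ‖tmul w - tmul v‖ =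
      √((∏ i, inner ℝ (w i) (w i)) - 2 * (∏ i, inner ℝ (w i) (v i)) + ∏ i, inner ℝ (v i) (v i)) :=
    fun w => by
      rw [← Real.sqrt_sq (norm_nonneg (tmul w - tmul v)), norm_sub_sq_real,
        ← real_inner_self_eq_norm_sq, ← real_inner_self_eq_norm_sq, inner_tmul, inner_tmul,
        inner_tmul]
  simp only [e]
  have hc : Continuous fun w : Fin m → H => √((∏ i, inner ℝ (w i) (w i)) -
      2 * (∏ i, inner ℝ (w i) (v i)) + ∏ i, inner ℝ (v i) (v i)) := by fun_prop
  convert! hc.tendsto v using 2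
  ring_nf
  simp

/-- Compounds of a locally bounded, strongly continuous family are strongly continuous. -/
theorem continuous_tensorMap_apply {α : Type*} [TopologicalSpace α] {G : α → H →L[ℝ] H}
    (hb : ∀ a, ∃ C, ∀ᶠ b in 𝓝 a, ‖G b‖ ≤ C) (hc : ∀ v, Continuous fun a => G a v)
    (x : TensorPow H m) : Continuous fun a => tensorMap m (G a) x := by
  refine continuous_apply_of_dense (fun a => ?_) UniformSpace.Completion.denseRange_coe
    (fun y => ?_) x
  · obtain ⟨C, hC⟩ := hb a
    refine ⟨C ^ m, hC.mono fun b h => (norm_tensorMap_le _).trans ?_⟩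
    exact pow_le_pow_left₀ (norm_nonneg _) h m
  · obtain ⟨N, c, v, rfl⟩ := exists_sum_tmul y
    have e : ∀ a, tensorMap m (G a) ((∑ i, c i • tmul (v i) : AlgTensor H m) : TensorPow H m) =
        ((∑ i, c i • tmul (fun k => G a (v i k)) : AlgTensor H m) : TensorPow H m) := fun a => by
      simp [tensorMap, algMap_tmul]
    simp only [e]
    have ht : ∀ i, Continuous fun a => (tmul fun k => G a (v i k) : AlgTensor H m) := fun i =>
      continuous_tmul.comp (continuous_pi fun k => hc _)
    exact (UniformSpace.Completion.continuous_coe _).comp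
      (continuous_finsetSum _ fun i _ => (ht i).const_smul (c i))

theorem continuous_extMap_apply {α : Type*} [TopologicalSpace α] {G : α → H →L[ℝ] H}
    (hb : ∀ a, ∃ C, ∀ᶠ b in 𝓝 a, ‖G b‖ ≤ C) (hc : ∀ v, Continuous fun a => G a v)
    (x : ExtPow H m) : Continuous fun a => extMap m (G a) x :=
  Continuous.subtype_mk (continuous_tensorMap_apply hb hc (x : TensorPow H m)) _

end Tensor

/-! ### The cocycle of the delay equation -/

namespace DelaySystem

variable {P M U X : Type*} [MetricSpace P]
  [NormedAddCommGroup M] [InnerProductSpace ℝ M]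
  [NormedAddCommGroup U] [InnerProductSpace ℝ U]
  [NormedAddCommGroup X] [InnerProductSpace ℝ X] (D : DelaySystem P M U X)

/-- A solution shifted by the time `s` is a solution over the shifted base point. -/
theorem IsSolution.shift {D : DelaySystem P M U X} {p : P} {ψ : C(Icc (-D.τ) 0, X)}
    {x : C(ℝ, X)} (hx : D.IsSolution p ψ x) (s : ℝ≥0) :
    D.IsSolution (D.flow s p) (D.hist x s) (x.comp ⟨fun t => s + t, by fun_prop⟩) where
  initial _ := rfl
  hasDeriv t ht := by
    have hst : 0 ≤ s + t := add_nonneg s.2 ht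
    have e1 : D.hist (x.comp ⟨fun t => s + t, by fun_prop⟩) t = D.hist x (s + t) := by
      ext1 θ
      simp [hist, add_assoc]
    have e2 : D.rhs (D.flow s p) t = D.rhs p (s + t) := by
      rw [rhs, rhs, Real.toNNReal_add s.coe_nonneg ht, Real.toNNReal_coe, add_comm s, D.flow.map_add]
    rw [e1, e2]
    have h := (hx.hasDeriv _ hst).scomp t (h := fun t => (s : ℝ) + t) (h' := 1) (s := Ici 0)
      ((hasDerivWithinAt_id t _).const_add _) fun r hr => mem_Ici.2 (add_nonneg s.2 (mem_Ici.1 hr))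
    simpa using! h

variable [FiniteDimensional ℝ X] [FiniteDimensional ℝ M]

theorem cocycle_add (s t : ℝ≥0) (p : P) :
    D.cocycle (s + t) p = D.cocycle s (D.flow t p) ∘L D.cocycle t p := by
  have : CompleteSpace X := FiniteDimensional.complete ℝ X
  refine ContinuousLinearMap.ext fun v => ?_
  refine D.denseRange_incl.induction_on v (isClosed_eq (by fun_prop) (by fun_prop)) fun ψ => ?_
  obtain ⟨x, hx⟩ := D.exists_isSolution p ψ
  rw [ContinuousLinearMap.comp_apply, D.cocycle_incl _ hx, D.cocycle_incl _ hx,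
    D.cocycle_incl _ (hx.shift t)]
  congr 1
  ext1 θ
  simp [hist, add_assoc, add_left_comm]

/-- The cocycle is bounded on compact time intervals, uniformly in the base point. -/
theorem exists_norm_cocycle_le (T : ℝ≥0) :
    ∃ K : ℝ, ∀ (t : ℝ≥0) (p : P), t ≤ T → ‖D.cocycle t p‖ ≤ K := by
  have : CompleteSpace X := FiniteDimensional.complete ℝ X
  obtain ⟨K, hK⟩ := D.exists_norm_incl_hist_le T
  refine ⟨|K|, fun t p ht => ContinuousLinearMap.opNorm_le_bound _ (abs_nonneg K) fun v => ?_⟩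
  refine D.denseRange_incl.induction_on v (isClosed_le (by fun_prop) (by fun_prop)) fun ψ => ?_
  obtain ⟨x, hx⟩ := D.exists_isSolution p ψ
  rw [D.cocycle_incl _ hx]
  exact (hK p ψ x hx t ⟨t.2, ht⟩).trans
    (mul_le_mul_of_nonneg_right (le_abs_self K) (norm_nonneg _))

theorem exists_eventually_norm_cocycle_le (p : P) (t : ℝ≥0) :
    ∃ K : ℝ, ∀ᶠ s in 𝓝 t, ‖D.cocycle s p‖ ≤ K := by
  obtain ⟨K, hK⟩ := D.exists_norm_cocycle_le (t + 1)
  exact ⟨K, (eventually_le_nhds (lt_add_one t)).mono fun s hs => hK s p hs⟩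

theorem continuous_cocycle_apply (p : P) (v : D.H) : Continuous fun t => D.cocycle t p v := by
  have : CompleteSpace X := FiniteDimensional.complete ℝ X
  refine continuous_apply_of_dense (D.exists_eventually_norm_cocycle_le p) D.denseRange_incl
    (fun ψ => ?_) v
  obtain ⟨x, hx⟩ := D.exists_isSolution p ψ
  simp only [fun t => D.cocycle_incl t hx]
  exact D.incl.continuous.comp ((D.continuous_hist x).comp NNReal.continuous_coe)

end DelaySystem

end DelayCompound

end

theorem mainTheorem6 {P M U : Type*} [MetricSpace P] [CompleteSpace P]
    [NormedAddCommGroup M] [InnerProductSpace ℝ M] [FiniteDimensional ℝ M]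
    [NormedAddCommGroup U] [InnerProductSpace ℝ U] [FiniteDimensional ℝ U]
    {n m : ℕ} (hm : 1 ≤ m)
    (D : DelayCompound.DelaySystem P M U (EuclideanSpace ℝ (Fin n)))
    (Q : DelayCompound.ExtPow D.H m →L[ℝ] DelayCompound.ExtPow D.H m)
    (hQ : IsSelfAdjoint Q)
    (V : DelayCompound.ExtPow D.H m → ℝ)
    (hVQ : ∀ Φ, V Φ = inner ℝ Φ (Q Φ))
    (hVpos : ∀ Φ, Φ ≠ 0 → 0 < V Φ)
    (ν₀ δ : ℝ) (hδ : 0 < δ)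
    (hV : ∀ (t : NNReal) (p : P) (Φ : DelayCompound.ExtPow D.H m),
      Real.exp (2 * ν₀ * t) * V (D.compoundCocycle m t p Φ) - V Φ ≤
        -δ * ∫ s in (0 : ℝ)..t,
          Real.exp (2 * ν₀ * s) * ‖D.compoundCocycle m s.toNNReal p Φ‖ ^ 2) :
    (∃ K : ℝ, 0 < K ∧ ∀ (Φ : DelayCompound.ExtPow D.H m) (p : P) (t : NNReal),
      ‖D.compoundCocycle m t p Φ‖ ≤ K * Real.exp (-ν₀ * t) * ‖Φ‖) ∧
    (0 < ν₀ → DelayCompound.IsUniformlyExponentiallyStable (D.compoundCocycle m) ν₀) := by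
  have hbound : ∃ K : ℝ, 0 < K ∧ ∀ (Φ : DelayCompound.ExtPow D.H m) (p : P) (t : NNReal),
      ‖D.compoundCocycle m t p Φ‖ ≤ K * Real.exp (-ν₀ * t) * ‖Φ‖ := by
    obtain ⟨L, hL⟩ := D.exists_norm_cocycle_le 1
    refine DelayCompound.exists_bound_of_integral_le (D.compoundCocycle m) (fun t => D.flow t)
      (fun s t p => ?_)
      (fun p => DelayCompound.continuous_extMap_apply (D.exists_eventually_norm_cocycle_le p)
        (D.continuous_cocycle_apply p))
      (L := L ^ m) (fun t ht p => (DelayCompound.norm_extMap_le _).trans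
        (pow_le_pow_left₀ (norm_nonneg _) (hL t p ht) m))
      (c := ‖Q‖ / δ) (fun t p Φ => ?_)
    · rw [DelayCompound.DelaySystem.compoundCocycle, D.cocycle_add, DelayCompound.extMap_comp]
      rfl
    · have hV0 : ∀ Φ, 0 ≤ V Φ := fun Φ => by
        rcases eq_or_ne Φ 0 with rfl | h
        · simp [hVQ]
        · exact (hVpos Φ h).le
      have h1 : V Φ ≤ ‖Q‖ * ‖Φ‖ ^ 2 := by
        rw [hVQ]
        calc _ ≤ ‖Φ‖ * ‖Q Φ‖ := real_inner_le_norm _ _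
          _ ≤ ‖Φ‖ * (‖Q‖ * ‖Φ‖) := by gcongr; exact Q.le_opNorm Φ
          _ = _ := by ring
      have h2 := mul_nonneg (Real.exp_pos (2 * ν₀ * t)).le (hV0 (D.compoundCocycle m t p Φ))
      have h3 := hV t p Φ
      rw [div_mul_eq_mul_div, le_div_iff₀ hδ]
      linarith
  refine ⟨hbound, fun hν => ⟨hν, ?_⟩⟩
  obtain ⟨K, hK, h⟩ := hbound
  exact ⟨K, hK, fun t p v => h v p t⟩
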